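/- Let $\triangle=\{(x,y)\in\mathbb R^2: 1\ge x\ge y>0\}$ with closure $\overline\triangle$, and for an integer $k\ge 0$ let $\triangle_k=\{(x,y)\in\triangle: 1-x-ky\ge 0>1-x-(k+1)y\}$. The Triangle Map $T:\triangle\to\overline\triangle$ is $$T(x,y)=\Big(\frac yx,\frac{1-x-ky}{x}\Big)\quad\text{for }(x,y)\in\triangle_k .$$ For a sequence $(\alpha_k)_{k\ge0}$ of non-negative integers put $$\triangle(\alpha_0,\dots,\alpha_k)=\{(x,y)\in\triangle: T^j(x,y)\in\triangle_{\alpha_j}\text{ for all }j=0,\dots,k\},\qquad \mathfrak L=\bigcap_{k\ge0}\triangle(\alpha_0,\dots,\alpha_k).$$ Call $(\alpha_k)_{k\ge 0}$ a non-convergent triangle sequence if $\mathfrak L$ contains at least two points. Define integer vectors $X_k=(q_k,p_k,r_k)$, $k\ge-3$, by $X_{-3}=(0,0,1)$, $X_{-2}=(1,0,0)$, $X_{-1}=(1,1,0)$ and $X_k=X_{k-3}+X_{k-1}+\alpha_kX_{k-2}$ for $k\ge0$, and let $\hat X_k=(p_k/q_k,\,r_k/q_k)$ for $k\ge 0$.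 On $\overline\triangle$ let $$\phi_0(x,y)=\Big(\frac1{1+y},\frac{x}{1+y}\Big),\qquad \phi_1(x,y)=\Big(\frac{x}{1+y},\frac{y}{1+y}\Big).$$ **Proposition.** Let $(\alpha_k)_{k\ge0}$ be a non-convergent triangle sequence. Then $\mathfrak L$ is a closed line segment with two distinct endpoints $\mathfrak p_{\mathfrak L}$ and $\mathfrak q_{\mathfrak L}$ such that $\hat X_{2k}\to\mathfrak p_{\mathfrak L}$ and $\hat X_{2k+1}\to\mathfrak q_{\mathfrak L}$ as $k\to+\infty$. Moreover, for all $(x,y)\in\overline\triangle\setminus\{(0,0)\}$, $$\lim_{k\to+\infty}\phi_1^{\alpha_0}\phi_0\cdots\phi_1^{\alpha_{2k}}\phi_0(x,y)=\mathfrak p_{\mathfrak L},\qquad \lim_{k\to+\infty}\phi_1^{\alpha_0}\phi_0\cdots\phi_1^{\alpha_{2k+1}}\phi_0(x,y)=\mathfrak q_{\mathfrak L},$$ and $$\lim_{k\to+\infty}\phi_1^{\alpha_0}\phi_0\cdots\phi_1^{\alpha_{2k}}\phi_0(0,0)=\mathfrak q_{\mathfrak L},\qquad \lim_{k\to+\infty}\phi_1^{\alpha_0}\phi_0\cdots\phi_1^{\alpha_{2k+1}}\phi_0(0,0)=\mathfrak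 p_{\mathfrak L}.$$ -/

import Mathlib

open Set Filter Topology

noncomputable section

namespace TriangleSeq

/-- The triangle `1 ≥ x ≥ y > 0`. Its topological closure is the closed triangle. -/
def triangle : Set (ℝ × ℝ) := {z | z.1 ≤ 1 ∧ z.2 ≤ z.1 ∧ 0 < z.2}

/-- The subtriangle of the points of `triangle` with `1 - x - k y ≥ 0 > 1 - x - (k + 1) y`. -/
def subtriangle (k : ℕ) : Set (ℝ × ℝ) :=
  {z | z ∈ triangle ∧ 0 ≤ 1 - z.1 - k * z.2 ∧ 1 - z.1 - (k + 1) * z.2 < 0}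

/-- The Triangle Map `T (x, y) = (y / x, (1 - x - k y) / x)` for `(x, y) ∈ subtriangle k`.
The index `k` is the integer part of `(1 - x) / y` (see `triangleMap_of_mem`). The map is only
meant on `triangle`; its values elsewhere are irrelevant. -/
def triangleMap (z : ℝ × ℝ) : ℝ × ℝ :=
  (z.2 / z.1, (1 - z.1 - (⌊(1 - z.1) / z.2⌋₊ : ℝ) * z.2) / z.1)

theorem triangleMap_of_mem {k : ℕ} {z : ℝ × ℝ} (hz : z ∈ subtriangle k) :
    triangleMap z = (z.2 / z.1, (1 - z.1 - k * z.2) / z.1) := by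
  obtain ⟨⟨h1, h2, h3⟩, h4, h5⟩ := hz
  have hk : ⌊(1 - z.1) / z.2⌋₊ = k := by
    rw [Nat.floor_eq_iff (div_nonneg (by linarith) h3.le)]
    exact ⟨by rw [le_div_iff₀ h3]; linarith, by rw [div_lt_iff₀ h3]; linarith⟩
  rw [triangleMap, hk]

/-- The points of `triangle` whose triangle sequence starts with `α 0, …, α k`. Every iterate
of the Triangle Map that occurs is taken at a point whose earlier iterates lie in `triangle`. -/
def cylinder (α : ℕ → ℕ) (k : ℕ) : Set (ℝ × ℝ) :=
  {z | z ∈ triangle ∧ ∀ j ≤ k, triangleMap^[j] z ∈ subtriangle (α j)}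

/-- The set of all points whose triangle sequence is `α`. -/
def limitSet (α : ℕ → ℕ) : Set (ℝ × ℝ) := ⋂ k, cylinder α k

/-- The infinite triangle sequence `α` is non-convergent: it does not describe a unique point,
that is, two distinct points have the triangle sequence `α`. -/
def NonConvergent (α : ℕ → ℕ) : Prop := (limitSet α).Nontrivial

/-- The integer vectors `(q, p, r)` of the recursion, with the index shifted by three:
`vec α n` is the vector of index `n - 3`. -/
def vec (α : ℕ → ℕ) : ℕ → Fin 3 → ℤ
  | 0 => ![0, 0, 1]
  | 1 => ![1, 0, 0]
  | 2 => ![1, 1, 0]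
  | n + 3 => vec α n + vec α (n + 2) + (α n : ℤ) • vec α (n + 1)

/-- The pair `(p / q, r / q)` of an integer vector `(q, p, r)`. -/
def pairOf (v : Fin 3 → ℤ) : ℝ × ℝ := ((v 1 : ℝ) / (v 0 : ℝ), (v 2 : ℝ) / (v 0 : ℝ))

/-- The rational pair of index `k ≥ 0`. -/
def hatX (α : ℕ → ℕ) (k : ℕ) : ℝ × ℝ := pairOf (vec α (k + 3))

/-- The inverse branch `(x, y) ↦ (1 / (1 + y), x / (1 + y))`, on the whole closed triangle. -/
def phi0 (z : ℝ × ℝ) : ℝ × ℝ := (1 / (1 + z.2), z.1 / (1 + z.2))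

/-- The inverse branch `(x, y) ↦ (x / (1 + y), y / (1 + y))`. -/
def phi1 (z : ℝ × ℝ) : ℝ × ℝ := (z.1 / (1 + z.2), z.2 / (1 + z.2))

/-- The composition `φ₁^(α 0) ∘ φ₀ ∘ ⋯ ∘ φ₁^(α k) ∘ φ₀`. -/
def phiComp (α : ℕ → ℕ) : ℕ → ℝ × ℝ → ℝ × ℝ
  | 0 => phi1^[α 0] ∘ phi0
  | k + 1 => phiComp α k ∘ phi1^[α (k + 1)] ∘ phi0

end TriangleSeq

end

/-!
In homogeneous coordinates `(1, x, y)` the Triangle Map acts linearly: the iterates of a point are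
read off from its remainders `rem`, which satisfy `d n = d (n + 1) + α n * d (n + 2) + d (n + 3)`,
and the remainders at time `n` are the coordinates with respect to three consecutive vectors
`vec α n` (`expansion`). A point has triangle sequence `α` as soon as all its remainders are
nonnegative (`mem_limitSet_iff`), since the recursion then makes them positive and strictly
decreasing. So the limit set is an intersection of closed half-planes, hence compact and convex.
It lies on a line, because remainders tend to zero while the steps of the algorithm preserve
determinants up to sign (`collinear_of_mem_limitSet`); being nontrivial, it is a segment from `p`
to `q` (`exists_limitSet_eq_segment`).

By compactness the points `hatX α k` eventually enter every neighbourhood of this segment. An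
endpoint of the segment is a convex combination of `hatX α (k + 1)`, `hatX α (k + 2)` and
`hatX α k`, with at least as much weight on the second as on the third
(`exists_comb_of_mem_limitSet`), so it is already approached by one of the first two. Thus of two
consecutive points of large index one is close to `p` and the other to `q`. Hence they alternate
(`exists_parity`), which gives the limits along even and odd indices.

Finally `hatX α (k + 3)` is a convex combination of its three predecessors, with weight the ratio of
consecutive denominators on `hatX α (k + 2)`. As `hatX α (k + 2)` and `hatX α k` are close to the
other endpoint, this ratio tends to zero (`tendsto_ratio`). The composition `phiComp α k` maps
`(x, y)` to the projection of a combination of three consecutive vectors (`phiComp_eq`); for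
`x > 0` the vector of index `k` dominates, while `(0, 0)` goes to `hatX α (k - 1)`.
-/

namespace TriangleSeq

/-! ### Remainders and their dual vectors -/

/-- The remainders of `v` in the continued fraction algorithm with digits `α`: the coordinates
of `v` at time `n` are the three consecutive remainders of index `n`, `n + 1`, `n + 2`. For
`v = (1, x, y)` the `n`-th iterate of the Triangle Map is the pair of the second and third of these
divided by the first. -/
def rem (α : ℕ → ℕ) (v : Fin 3 → ℝ) : ℕ → ℝ
  | 0 => v 0
  | 1 => v 1
  | 2 => v 2
  | n + 3 => rem α v n - rem α v (n + 1) - α n * rem α v (n + 2)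

/-- The integer vectors `vec α n`, regarded as real vectors. -/
def rvec (α : ℕ → ℕ) (n : ℕ) : Fin 3 → ℝ := fun i => (vec α n i : ℝ)

/-- Homogeneous coordinates `(1, x, y)` of the point `(x, y)`. -/
def homog (z : ℝ × ℝ) : Fin 3 → ℝ := ![1, z.1, z.2]

theorem rvec_add_three (α : ℕ → ℕ) (n : ℕ) (i : Fin 3) :
    rvec α (n + 3) i = rvec α n i + rvec α (n + 2) i + α n * rvec α (n + 1) i := by
  simp [rvec, vec]

theorem rem_add_three (α : ℕ → ℕ) (v : Fin 3 → ℝ) (n : ℕ) :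
    rem α v (n + 3) = rem α v n - rem α v (n + 1) - α n * rem α v (n + 2) := by
  rw [rem]

theorem rem_add (α : ℕ → ℕ) (v w : Fin 3 → ℝ) (n : ℕ) :
    rem α (v + w) n = rem α v n + rem α w n := by
  induction n using Nat.strong_induction_on with
  | _ n ih =>
    match n, ih with
    | 0, _ => simp [rem]
    | 1, _ => simp [rem]
    | 2, _ => simp [rem]
    | n + 3, ih =>
      simp only [rem_add_three, ih n (by lia), ih (n + 1) (by lia), ih (n + 2) (by lia)]
      ring

theorem rem_smul (α : ℕ → ℕ) (c : ℝ) (v : Fin 3 → ℝ) (n : ℕ) :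
    rem α (c • v) n = c * rem α v n := by
  induction n using Nat.strong_induction_on with
  | _ n ih =>
    match n, ih with
    | 0, _ => simp [rem]
    | 1, _ => simp [rem]
    | 2, _ => simp [rem]
    | n + 3, ih =>
      simp only [rem_add_three, ih n (by lia), ih (n + 1) (by lia), ih (n + 2) (by lia)]
      ring

theorem rem_rvec_add_three (α : ℕ → ℕ) (m n : ℕ) :
    rem α (rvec α (m + 3)) n = rem α (rvec α m) n + rem α (rvec α (m + 2)) n
      + α m * rem α (rvec α (m + 1)) n := by
  have : rvec α (m + 3) = rvec α m + rvec α (m + 2) + (α m : ℝ) • rvec α (m + 1) := by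
    ext i
    simp [rvec_add_three]
  rw [this, rem_add, rem_add, rem_smul]

/-- The remainders at time `n` of three consecutive vectors: these are unit coordinates, so the
remainders are dual to the vectors `vec α n`. -/
theorem rem_rvec (α : ℕ → ℕ) (n : ℕ) :
    (rem α (rvec α n) n = 0 ∧ rem α (rvec α n) (n + 1) = 0 ∧ rem α (rvec α n) (n + 2) = 1) ∧
    (rem α (rvec α (n + 1)) n = 1 ∧ rem α (rvec α (n + 1)) (n + 1) = 0 ∧
      rem α (rvec α (n + 1)) (n + 2) = 0) ∧
    (rem α (rvec α (n + 2)) n = 1 ∧ rem α (rvec α (n + 2)) (n + 1) = 1 ∧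
      rem α (rvec α (n + 2)) (n + 2) = 0) := by
  induction n with
  | zero => simp [rem, rvec, vec]
  | succ n ih =>
    obtain ⟨⟨a0, a1, a2⟩, ⟨b0, b1, b2⟩, ⟨c0, c1, c2⟩⟩ := ih
    refine ⟨⟨b1, b2, ?_⟩, ⟨c1, c2, ?_⟩, ?_, ?_, ?_⟩
    · rw [show n + 1 + 2 = n + 3 by rfl, rem_add_three, b0, b1, b2]; ring
    · rw [show n + 1 + 2 = n + 3 by rfl, show n + 1 + 1 = n + 2 by rfl, rem_add_three, c0, c1, c2]
      ring
    · rw [show n + 1 + 2 = n + 3 by rfl, rem_rvec_add_three, a1, b1, c1]; ring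
    · rw [show n + 1 + 2 = n + 3 by rfl, show n + 1 + 1 = n + 2 by rfl, rem_rvec_add_three,
        a2, b2, c2]; ring
    · rw [show n + 1 + 2 = n + 3 by rfl, rem_rvec_add_three]
      simp only [rem_add_three, a0, a1, a2, b0, b1, b2, c0, c1, c2]; ring

theorem rem_rvec_nonneg (α : ℕ → ℕ) (n m : ℕ) : 0 ≤ rem α (rvec α (n + m)) n := by
  obtain ⟨⟨a0, -⟩, ⟨b0, -⟩, ⟨c0, -⟩⟩ := rem_rvec α n
  induction m using Nat.strong_induction_on with
  | _ m ih =>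
    match m, ih with
    | 0, _ => exact a0.ge
    | 1, _ => exact b0 ▸ zero_le_one
    | 2, _ => exact c0 ▸ zero_le_one
    | m + 3, ih =>
      rw [← add_assoc, rem_rvec_add_three]
      have h0 := ih m (by lia)
      have h1 := ih (m + 1) (by lia)
      have h2 := ih (m + 2) (by lia)
      rw [← add_assoc] at h1 h2
      positivity

/-- The remainders are the coordinates with respect to three consecutive vectors. -/
theorem expansion (α : ℕ → ℕ) (v : Fin 3 → ℝ) (n : ℕ) (i : Fin 3) :
    v i = (rem α v n - rem α v (n + 1)) * rvec α (n + 1) i + rem α v (n + 1) * rvec α (n + 2) i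
      + rem α v (n + 2) * rvec α n i := by
  induction n with
  | zero => fin_cases i <;> simp [rem, rvec, vec]
  | succ n ih =>
    rw [show n + 1 + 2 = n + 3 by rfl, show n + 1 + 1 = n + 2 by rfl, rem_add_three,
      rvec_add_three]
    rw [ih]
    ring

/-! ### The limit set as an intersection of half-planes -/

theorem rem_add_three_eq (α : ℕ → ℕ) (v : Fin 3 → ℝ) (n : ℕ) :
    rem α v n = rem α v (n + 1) + α n * rem α v (n + 2) + rem α v (n + 3) := by
  rw [rem_add_three]; ring

theorem rem_succ_le {α : ℕ → ℕ} {v : Fin 3 → ℝ} (h : ∀ n, 0 ≤ rem α v n) (n : ℕ) :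
    rem α v (n + 1) ≤ rem α v n := by
  have h2 := h (n + 2)
  have h3 := h (n + 3)
  have : 0 ≤ (α n : ℝ) * rem α v (n + 2) := by positivity
  linarith [rem_add_three_eq α v n]

/-- Nonnegative remainders are positive: a vanishing remainder forces all later ones, and then
by the recursion all earlier ones, to vanish. -/
theorem rem_pos {α : ℕ → ℕ} {v : Fin 3 → ℝ} (hv : 0 < v 0) (h : ∀ n, 0 ≤ rem α v n) (n : ℕ) :
    0 < rem α v n := by
  have anti : Antitone (rem α v) := antitone_nat_of_succ_le (rem_succ_le h)
  induction n with
  | zero => exact hv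
  | succ n ih =>
    refine (h _).lt_of_ne' fun h0 => ih.ne' ?_
    have h2 : rem α v (n + 2) = 0 := le_antisymm (h0 ▸ anti (by lia)) (h _)
    have h3 : rem α v (n + 3) = 0 := le_antisymm (h0 ▸ anti (by lia)) (h _)
    rw [rem_add_three_eq, h0, h2, h3]; ring

theorem rem_succ_lt {α : ℕ → ℕ} {v : Fin 3 → ℝ} (hv : 0 < v 0) (h : ∀ n, 0 ≤ rem α v n) (n : ℕ) :
    rem α v (n + 1) < rem α v n := by
  have h2 := h (n + 2)
  have h3 := rem_pos hv h (n + 3)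
  have : 0 ≤ (α n : ℝ) * rem α v (n + 2) := by positivity
  linarith [rem_add_three_eq α v n]

theorem tendsto_rem {α : ℕ → ℕ} {v : Fin 3 → ℝ} (h : ∀ n, 0 ≤ rem α v n) :
    Tendsto (rem α v) atTop (𝓝 0) := by
  have anti : Antitone (rem α v) := antitone_nat_of_succ_le (rem_succ_le h)
  have hL := tendsto_atTop_ciInf anti ⟨0, by rintro _ ⟨n, rfl⟩; exact h n⟩
  set L := ⨅ n, rem α v n
  have h0 : 0 ≤ L := le_ciInf h
  have h2 : L + L ≤ L := by
    refine le_of_tendsto_of_tendsto' ((hL.comp (tendsto_add_atTop_nat 1)).add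
      (hL.comp (tendsto_add_atTop_nat 3))) hL fun n => ?_
    have h2 := h (n + 2)
    have : 0 ≤ (α n : ℝ) * rem α v (n + 2) := by positivity
    simp only [Function.comp]
    linarith [rem_add_three_eq α v n]
  rwa [show L = 0 by linarith] at hL

theorem triangleMap_rem {α : ℕ → ℕ} {v : Fin 3 → ℝ} {n : ℕ} (h0 : 0 < rem α v n)
    (h1 : 0 < rem α v (n + 1))
    (h : (rem α v (n + 1) / rem α v n, rem α v (n + 2) / rem α v n) ∈ subtriangle (α n)) :
    triangleMap (rem α v (n + 1) / rem α v n, rem α v (n + 2) / rem α v n) =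
      (rem α v (n + 2) / rem α v (n + 1), rem α v (n + 3) / rem α v (n + 1)) := by
  rw [triangleMap_of_mem h, rem_add_three]
  ext <;> field_simp

theorem mem_limitSet_iff {α : ℕ → ℕ} {z : ℝ × ℝ} :
    z ∈ limitSet α ↔ ∀ n, 0 ≤ rem α (homog z) n := by
  set D := rem α (homog z) with hD
  constructor
  · intro hz
    have hsub : ∀ j, triangleMap^[j] z ∈ subtriangle (α j) := fun j =>
      ((mem_iInter.1 hz j).2 j le_rfl)
    have key : ∀ j, 0 < D j ∧ triangleMap^[j] z = (D (j + 1) / D j, D (j + 2) / D j) := by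
      intro j
      induction j with
      | zero => simp [hD, rem, homog]
      | succ j ih =>
        obtain ⟨h0, hj⟩ := ih
        have hs := hj ▸ hsub j
        have h1 : 0 < D (j + 1) := by
          have h := hs.1.2.2.trans_le hs.1.2.1
          exact (div_pos_iff_of_pos_right h0).1 h
        exact ⟨h1, by rw [Function.iterate_succ_apply', hj, triangleMap_rem h0 h1 hs]⟩
    exact fun n => (key n).1.le
  · intro h
    have hv : 0 < homog z 0 := by simp [homog]
    have pos := rem_pos hv h
    have lt := rem_succ_lt hv h
    have hs : ∀ j, (D (j + 1) / D j, D (j + 2) / D j) ∈ subtriangle (α j) := by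
      intro j
      have p0 := pos j
      have e1 : 1 - D (j + 1) / D j - α j * (D (j + 2) / D j) = D (j + 3) / D j := by
        have p : 0 < D j := p0
        rw [show D (j + 3) = D j - D (j + 1) - α j * D (j + 2) from rem_add_three ..]
        field_simp
      have l3 : D (j + 3) / D j < D (j + 2) / D j := by gcongr; exact lt (j + 2)
      refine ⟨⟨?_, ?_, div_pos (pos _) p0⟩, ?_, ?_⟩
      · exact (div_le_one p0).2 (lt j).le
      · show D (j + 2) / D j ≤ D (j + 1) / D j
        gcongr; exact (lt (j + 1)).le
      · show 0 ≤ 1 - D (j + 1) / D j - α j * (D (j + 2) / D j)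
        rw [e1]; exact (div_pos (pos _) p0).le
      · show 1 - D (j + 1) / D j - (α j + 1) * (D (j + 2) / D j) < 0
        linarith
    have key : ∀ j, triangleMap^[j] z = (D (j + 1) / D j, D (j + 2) / D j) := by
      intro j
      induction j with
      | zero => simp [hD, rem, homog]
      | succ j ih =>
        rw [Function.iterate_succ_apply', ih, triangleMap_rem (pos j) (pos _) (hs j)]
    refine mem_iInter.2 fun k => ⟨?_, fun j _ => key j ▸ hs j⟩
    have := (hs 0).1
    rwa [← key 0] at this

/-! ### The limit set is a segment -/

/-- The remainders are affine functions of the point. -/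
theorem rem_homog (α : ℕ → ℕ) (n : ℕ) (z : ℝ × ℝ) :
    rem α (homog z) n =
      rem α ![1, 0, 0] n + z.1 * rem α ![0, 1, 0] n + z.2 * rem α ![0, 0, 1] n := by
  have : homog z = ![1, 0, 0] + z.1 • ![0, 1, 0] + z.2 • ![0, 0, 1] := by
    ext i; fin_cases i <;> simp [homog]
  rw [this, rem_add, rem_add, rem_smul, rem_smul]

theorem continuous_rem_homog (α : ℕ → ℕ) (n : ℕ) : Continuous fun z => rem α (homog z) n := by
  simp only [rem_homog]; fun_prop

/-- The points whose first `N + 5` remainders are nonnegative. Those of index at most `4`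
bound the coordinates, so that this set is compact for every `N`. -/
def approxSet (α : ℕ → ℕ) (N : ℕ) : Set (ℝ × ℝ) := {z | ∀ n ≤ N + 4, 0 ≤ rem α (homog z) n}

theorem isClosed_approxSet (α : ℕ → ℕ) (N : ℕ) : IsClosed (approxSet α N) := by
  simp only [approxSet, ofPred_forall]
  exact isClosed_iInter fun n => isClosed_iInter fun _ =>
    isClosed_le continuous_const (continuous_rem_homog α n)

theorem isCompact_approxSet (α : ℕ → ℕ) (N : ℕ) : IsCompact (approxSet α N) := by
  refine (isCompact_Icc (a := ((0 : ℝ), (0 : ℝ))) (b := (1, 1))).of_isClosed_subset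
    (isClosed_approxSet α N) fun z hz => ?_
  have h1 := hz 1 (by lia)
  have h2 := hz 2 (by lia)
  have h3 := hz 3 (by lia)
  have h4 := hz 4 (by lia)
  have e : rem α (homog z) 4 = rem α (homog z) 1 - rem α (homog z) 2 - α 1 * rem α (homog z) 3 :=
    rem_add_three ..
  rw [e] at h4
  have h43 : 0 ≤ (α 1 : ℝ) * rem α (homog z) 3 := by positivity
  have h32 : 0 ≤ (α 0 : ℝ) * rem α (homog z) 2 := by positivity
  simp only [rem, homog, Fin.isValue, Matrix.cons_val] at h1 h2 h3 h4 h43 h32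
  exact ⟨⟨h1, h2⟩, by show z.1 ≤ 1; linarith, by show z.2 ≤ 1; linarith⟩

theorem antitone_approxSet (α : ℕ → ℕ) : Antitone (approxSet α) :=
  fun _ _ h _ hz n hn => hz n (hn.trans (by lia))

theorem iInter_approxSet (α : ℕ → ℕ) : ⋂ N, approxSet α N = limitSet α := by
  ext z
  rw [mem_limitSet_iff, mem_iInter]
  exact ⟨fun h n => h n n (by lia), fun h N n _ => h n⟩

theorem isCompact_limitSet (α : ℕ → ℕ) : IsCompact (limitSet α) := by
  rw [← iInter_approxSet]
  exact (isCompact_approxSet α 0).of_isClosed_subset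
    (isClosed_iInter (isClosed_approxSet α)) (iInter_subset _ _)

theorem convex_limitSet (α : ℕ → ℕ) : Convex ℝ (limitSet α) := by
  intro z hz w hw a b ha hb hab
  rw [mem_limitSet_iff] at *
  intro n
  have e : rem α (homog (a • z + b • w)) n = a * rem α (homog z) n + b * rem α (homog w) n := by
    have : homog (a • z + b • w) = a • homog z + b • homog w := by
      ext i; fin_cases i <;> simp [homog, hab]
    rw [this, rem_add, rem_smul, rem_smul]
  rw [e]
  have := hz n
  have := hw n
  positivity

/-- The determinant of the vectors of remainders at time `n` is, up to sign, that of the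
original vectors. -/
theorem abs_det_rem (α : ℕ → ℕ) (u v w : Fin 3 → ℝ) (n : ℕ) :
    |(Matrix.of ![fun i : Fin 3 => rem α u (n + i), fun i => rem α v (n + i),
      fun i => rem α w (n + i)]).det| = |(Matrix.of ![u, v, w]).det| := by
  induction n with
  | zero => simp [Matrix.det_fin_three, rem]
  | succ n ih =>
    rw [← ih]
    congr 1
    simp only [Matrix.det_fin_three, Matrix.of_apply, Fin.isValue, Matrix.cons_val, Fin.val_zero,
      Fin.val_one, Fin.val_two, add_zero, show n + 1 + 2 = n + 3 by rfl,
      show n + 1 + 1 = n + 2 by rfl, rem_add_three]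
    ring

theorem collinear_of_mem_limitSet {α : ℕ → ℕ} {a b c : ℝ × ℝ} (ha : a ∈ limitSet α)
    (hb : b ∈ limitSet α) (hc : c ∈ limitSet α) :
    (b.1 - a.1) * (c.2 - a.2) = (b.2 - a.2) * (c.1 - a.1) := by
  have ta := tendsto_rem (mem_limitSet_iff.1 ha)
  have tb := tendsto_rem (mem_limitSet_iff.1 hb)
  have tc := tendsto_rem (mem_limitSet_iff.1 hc)
  have hM : Tendsto (fun n => Matrix.of ![fun i : Fin 3 => rem α (homog a) (n + i),
      fun i => rem α (homog b) (n + i), fun i => rem α (homog c) (n + i)]) atTop (𝓝 0) := by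
    refine tendsto_pi_nhds.2 fun i => tendsto_pi_nhds.2 fun j => ?_
    fin_cases i
    · exact ta.comp (tendsto_add_atTop_nat j)
    · exact tb.comp (tendsto_add_atTop_nat j)
    · exact tc.comp (tendsto_add_atTop_nat j)
  have hdet := ((continuous_id.matrix_det.tendsto (0 : Matrix (Fin 3) (Fin 3) ℝ)).comp hM).abs
  simp only [Function.comp_def, id, abs_det_rem] at hdet
  have h0 := tendsto_nhds_unique tendsto_const_nhds hdet
  simp [Matrix.det_fin_three, homog] at h0
  linarith

/-- The affine coordinate along the line through `p` and `q`, with value `0` at `p` and `1` at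
`q`. -/
noncomputable def along (p q z : ℝ × ℝ) : ℝ :=
  ((z.1 - p.1) * (q.1 - p.1) + (z.2 - p.2) * (q.2 - p.2)) /
    ((q.1 - p.1) ^ 2 + (q.2 - p.2) ^ 2)

/-- The affine coordinate transversal to the line through `p` and `q`. -/
noncomputable def across (p q z : ℝ × ℝ) : ℝ :=
  ((z.2 - p.2) * (q.1 - p.1) - (z.1 - p.1) * (q.2 - p.2)) /
    ((q.1 - p.1) ^ 2 + (q.2 - p.2) ^ 2)

theorem sq_add_sq_pos_of_ne {p q : ℝ × ℝ} (h : p ≠ q) :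
    0 < (q.1 - p.1) ^ 2 + (q.2 - p.2) ^ 2 := by
  by_contra! h0
  apply h
  have h1 : (q.1 - p.1) ^ 2 = 0 := by nlinarith [sq_nonneg (q.1 - p.1), sq_nonneg (q.2 - p.2)]
  have h2 : (q.2 - p.2) ^ 2 = 0 := by nlinarith [sq_nonneg (q.1 - p.1), sq_nonneg (q.2 - p.2)]
  rw [sq_eq_zero_iff] at h1 h2
  ext <;> linarith

theorem eq_along_across {p q : ℝ × ℝ} (h : p ≠ q) (z : ℝ × ℝ) :
    z = (p.1 + along p q z * (q.1 - p.1) - across p q z * (q.2 - p.2),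
      p.2 + along p q z * (q.2 - p.2) + across p q z * (q.1 - p.1)) := by
  have := (sq_add_sq_pos_of_ne h).ne'
  ext <;> simp only [along, across] <;> field_simp <;> ring

theorem continuous_along (p q : ℝ × ℝ) : Continuous (along p q) := by
  unfold along; fun_prop

theorem continuous_across (p q : ℝ × ℝ) : Continuous (across p q) := by
  unfold across; fun_prop

theorem along_comm {p q : ℝ × ℝ} (h : p ≠ q) (z : ℝ × ℝ) : along q p z = 1 - along p q z := by
  have h1 := (sq_add_sq_pos_of_ne h).ne'
  have h2 := (sq_add_sq_pos_of_ne h.symm).ne'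
  unfold along; field_simp; ring

theorem along_left (p q : ℝ × ℝ) : along p q p = 0 := by simp [along]

theorem along_comb (p q a b c : ℝ × ℝ) {r s t : ℝ} (h : r + s + t = 1) :
    along p q (r • a + s • b + t • c) = r * along p q a + s * along p q b + t * along p q c := by
  obtain rfl : t = 1 - r - s := by linarith
  simp only [along, Prod.fst_add, Prod.snd_add, Prod.smul_fst, Prod.smul_snd, smul_eq_mul]
  ring

theorem along_mem_Icc {p q z : ℝ × ℝ} (h : p ≠ q) (hz : z ∈ segment ℝ p q) :
    along p q z ∈ Icc (0 : ℝ) 1 := by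
  obtain ⟨a, b, ha, hb, hab, rfl⟩ := hz
  have h1 := along_comb p q p q p (r := a) (s := b) (t := 0) (by linarith)
  have h2 : along p q q = 1 := by have := along_comm h q; rw [along_left] at this; linarith
  rw [zero_smul, add_zero, along_left, h2] at h1
  rw [h1]; constructor <;> linarith

theorem across_eq_zero {p q z : ℝ × ℝ} (hz : z ∈ segment ℝ p q) : across p q z = 0 := by
  obtain ⟨a, b, ha, hb, hab, rfl⟩ := hz
  obtain rfl : a = 1 - b := by linarith
  simp only [across, Prod.fst_add, Prod.snd_add, Prod.smul_fst, Prod.smul_snd, smul_eq_mul]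
  rw [div_eq_zero_iff]; left; ring

theorem exists_limitSet_eq_segment {α : ℕ → ℕ} (hα : NonConvergent α) :
    ∃ p q : ℝ × ℝ, p ≠ q ∧ limitSet α = segment ℝ p q := by
  obtain ⟨a, ha, b, hb, hab⟩ := hα
  have hpar : ∀ z ∈ limitSet α, z = a + along a b z • (b - a) := by
    intro z hz
    have h0 : across a b z = 0 := by
      rw [across, div_eq_zero_iff]; left; linarith [collinear_of_mem_limitSet ha hb hz]
    have := eq_along_across hab z
    rw [h0] at this
    refine this.trans ?_
    ext <;> simp
  obtain ⟨p, hp, hmin⟩ := (isCompact_limitSet α).exists_isMinOn ⟨a, ha⟩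
    (continuous_along a b).continuousOn
  obtain ⟨q, hq, hmax⟩ := (isCompact_limitSet α).exists_isMaxOn ⟨a, ha⟩
    (continuous_along a b).continuousOn
  have hbb : along a b b = 1 := by have := along_comm hab b; rw [along_left] at this; linarith
  have hlt : along a b p < along a b q := by
    have h1 := hmin ha
    have h2 := hmax hb
    simp only [mem_ofPred_eq, along_left, hbb] at h1 h2
    linarith
  refine ⟨p, q, fun h => hlt.ne (h ▸ rfl), Subset.antisymm (fun z hz => ?_)
    ((convex_limitSet α).segment_subset hp hq)⟩
  have h1 : along a b p ≤ along a b z := hmin hz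
  have h2 : along a b z ≤ along a b q := hmax hz
  have hd : 0 < along a b q - along a b p := by linarith
  rw [segment_eq_image']
  refine ⟨(along a b z - along a b p) / (along a b q - along a b p),
    ⟨div_nonneg (by linarith) hd.le, (div_le_one hd).2 (by linarith)⟩, ?_⟩
  have e : q - p = (along a b q - along a b p) • (b - a) := by
    conv_lhs => rw [hpar q hq, hpar p hp]
    rw [sub_smul]; abel
  show p + _ • (q - p) = z
  rw [e, smul_smul, div_mul_cancel₀ _ hd.ne', sub_smul]
  calc p + (along a b z • (b - a) - along a b p • (b - a))
      = a + along a b p • (b - a) + (along a b z • (b - a) - along a b p • (b - a)) := by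
        rw [← hpar p hp]
    _ = a + along a b z • (b - a) := by abel
    _ = z := (hpar z hz).symm

/-! ### Convex combinations of consecutive points `hatX` -/

theorem rvec_zero_pos (α : ℕ → ℕ) (n : ℕ) : 0 < rvec α (n + 1) 0 := by
  induction n using Nat.strong_induction_on with
  | _ n ih =>
    match n, ih with
    | 0, _ => simp [rvec, vec]
    | 1, _ => simp [rvec, vec]
    | 2, _ => simp [rvec, vec]; positivity
    | n + 3, ih =>
      have h0 := ih n (by lia)
      have h1 := ih (n + 1) (by lia)
      have h2 := ih (n + 2) (by lia)
      rw [show n + 3 + 1 = n + 1 + 3 by rfl, rvec_add_three]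
      positivity

theorem rvec_zero_le (α : ℕ → ℕ) (n : ℕ) : rvec α (n + 3) 0 ≤ rvec α (n + 4) 0 := by
  have h0 := rvec_zero_pos α n
  have h1 := rvec_zero_pos α (n + 1)
  have : 0 ≤ (α (n + 1) : ℝ) * rvec α (n + 1 + 1) 0 := by positivity
  have e : rvec α (n + 4) 0 = rvec α (n + 1) 0 + rvec α (n + 3) 0
    + α (n + 1) * rvec α (n + 1 + 1) 0 := rvec_add_three α (n + 1) 0
  linarith

theorem rvec_one (α : ℕ → ℕ) (k : ℕ) :
    rvec α (k + 3) 1 = rvec α (k + 3) 0 * (hatX α k).1 := by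
  have := (rvec_zero_pos α (k + 2)).ne'
  show _ = _ * (rvec α (k + 3) 1 / rvec α (k + 3) 0)
  field_simp

theorem rvec_two (α : ℕ → ℕ) (k : ℕ) :
    rvec α (k + 3) 2 = rvec α (k + 3) 0 * (hatX α k).2 := by
  have := (rvec_zero_pos α (k + 2)).ne'
  show _ = _ * (rvec α (k + 3) 2 / rvec α (k + 3) 0)
  field_simp

theorem rvec_eq_smul_lift (α : ℕ → ℕ) (k : ℕ) :
    rvec α (k + 3) = rvec α (k + 3) 0 • homog (hatX α k) := by
  ext i
  fin_cases i
  · simp [homog]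
  · simpa [homog] using rvec_one α k
  · simpa [homog] using rvec_two α k

theorem hatX_mem_approxSet (α : ℕ → ℕ) (k : ℕ) : hatX α (k + 1) ∈ approxSet α k := by
  intro n hn
  obtain ⟨m, hm⟩ := Nat.exists_eq_add_of_le hn
  have h := rem_rvec_nonneg α n m
  rw [← hm, show k + 4 = k + 1 + 3 by rfl, rvec_eq_smul_lift, rem_smul] at h
  exact nonneg_of_mul_nonneg_right h (rvec_zero_pos α _)

theorem eventually_hatX_mem {α : ℕ → ℕ} {U : Set (ℝ × ℝ)} (hU : IsOpen U)
    (h : limitSet α ⊆ U) : ∀ᶠ k in atTop, hatX α k ∈ U := by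
  rw [← iInter_approxSet] at h
  obtain ⟨N, hN⟩ := exists_subset_nhds_of_isCompact' (antitone_approxSet α).directed_ge
    (isCompact_approxSet α) (isClosed_approxSet α) fun x hx => hU.mem_nhds (h hx)
  filter_upwards [eventually_ge_atTop (N + 1)] with k hk
  obtain ⟨m, rfl⟩ := Nat.exists_eq_add_of_le' (Nat.one_le_of_lt hk)
  exact hN (antitone_approxSet α (by lia) (hatX_mem_approxSet α m))

/-- A point of the limit set lies in the triangle with vertices of index `k + 1`, `k + 2` and the
mediant of those of index `k` and `k + 2`; hence the inequality between the weights. -/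
theorem exists_comb_of_mem_limitSet {α : ℕ → ℕ} {z : ℝ × ℝ} (hz : z ∈ limitSet α) (k : ℕ) :
    ∃ a b c : ℝ, 0 ≤ a ∧ 0 ≤ c ∧ c ≤ b ∧ a + b + c = 1 ∧
      z = a • hatX α (k + 1) + b • hatX α (k + 2) + c • hatX α k := by
  have hD := mem_limitSet_iff.1 hz
  have e := expansion α (homog z) (k + 3)
  have q0 := rvec_zero_pos α (k + 2)
  have q1 := rvec_zero_pos α (k + 3)
  have q2 := rvec_zero_pos α (k + 4)
  set D := rem α (homog z)
  refine ⟨(D (k + 3) - D (k + 4)) * rvec α (k + 4) 0, D (k + 4) * rvec α (k + 5) 0,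
    D (k + 5) * rvec α (k + 3) 0, mul_nonneg (sub_nonneg.2 (rem_succ_le hD _)) q1.le,
    mul_nonneg (hD _) q0.le, ?_, (e 0).symm, ?_⟩
  · exact mul_le_mul (rem_succ_le hD _) ((rvec_zero_le α k).trans (rvec_zero_le α (k + 1)))
      q0.le (hD _)
  · have e1 := e 1
    have e2 := e 2
    rw [show k + 3 + 1 = k + 1 + 3 by rfl, show k + 3 + 2 = k + 2 + 3 by rfl, rvec_one, rvec_one,
      rvec_one] at e1
    rw [show k + 3 + 1 = k + 1 + 3 by rfl, show k + 3 + 2 = k + 2 + 3 by rfl, rvec_two, rvec_two,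
      rvec_two] at e2
    ext
    · simp only [Prod.fst_add, Prod.smul_fst, smul_eq_mul]
      simp only [homog, Matrix.cons_val] at e1
      rw [e1]; ring_nf
    · simp only [Prod.snd_add, Prod.smul_snd, smul_eq_mul]
      simp only [homog, Matrix.cons_val] at e2
      rw [e2]; ring_nf

theorem exists_comb_hatX (α : ℕ → ℕ) (k : ℕ) :
    ∃ a b c : ℝ, 0 ≤ a ∧ 0 ≤ b ∧ 0 ≤ c ∧ a + b + c = 1 ∧
      a = rvec α (k + 5) 0 / rvec α (k + 6) 0 ∧
      hatX α (k + 3) = a • hatX α (k + 2) + b • hatX α (k + 1) + c • hatX α k := by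
  have q0 := rvec_zero_pos α (k + 2)
  have q1 := rvec_zero_pos α (k + 3)
  have q2 := rvec_zero_pos α (k + 4)
  have q3 := rvec_zero_pos α (k + 5)
  simp only [add_assoc, Nat.reduceAdd] at q0 q1 q2 q3
  have e := rvec_add_three α (k + 3)
  simp only [add_assoc, Nat.reduceAdd] at e
  refine ⟨_, α (k + 3) * rvec α (k + 4) 0 / rvec α (k + 6) 0,
    rvec α (k + 3) 0 / rvec α (k + 6) 0, by positivity, by positivity, by positivity, ?_, rfl, ?_⟩
  · field_simp
    rw [e 0]; ring
  · have e1 := e 1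
    have e2 := e 2
    have o0 := rvec_one α k
    have o1 := rvec_one α (k + 1)
    have o2 := rvec_one α (k + 2)
    have o3 := rvec_one α (k + 3)
    have t0 := rvec_two α k
    have t1 := rvec_two α (k + 1)
    have t2 := rvec_two α (k + 2)
    have t3 := rvec_two α (k + 3)
    simp only [add_assoc, Nat.reduceAdd] at o1 o2 o3 t1 t2 t3
    rw [o0, o1, o2, o3] at e1
    rw [t0, t1, t2, t3] at e2
    ext
    · simp only [Prod.fst_add, Prod.smul_fst, smul_eq_mul]
      field_simp
      linarith
    · simp only [Prod.snd_add, Prod.smul_snd, smul_eq_mul]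
      field_simp
      linarith

/-! ### Alternation of the points `hatX` -/

/-- A real sequence that stays close to `[0, 1]`, and of which any two consecutive terms come
close to both `0` and `1`, alternates between them. -/
theorem tendsto_even_odd_of_alternating {t : ℕ → ℝ}
    (hr : ∀ ε > 0, ∀ᶠ k in atTop, -ε < t k ∧ t k < 1 + ε)
    (h0 : ∀ ε > 0, ∀ᶠ k in atTop, t k ≤ ε ∨ t (k + 1) ≤ ε)
    (h1 : ∀ ε > 0, ∀ᶠ k in atTop, 1 - ε ≤ t k ∨ 1 - ε ≤ t (k + 1)) :
    (Tendsto (fun k => t (2 * k)) atTop (𝓝 0) ∧ Tendsto (fun k => t (2 * k + 1)) atTop (𝓝 1)) ∨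
    (Tendsto (fun k => t (2 * k)) atTop (𝓝 1) ∧ Tendsto (fun k => t (2 * k + 1)) atTop (𝓝 0)) := by
  have hall : ∀ ε > 0, ∃ N, ∀ k ≥ N, (-ε < t k ∧ t k < 1 + ε) ∧ (t k ≤ ε ∨ t (k + 1) ≤ ε) ∧
      (1 - ε ≤ t k ∨ 1 - ε ≤ t (k + 1)) := fun ε hε =>
    eventually_atTop.1 ((hr ε hε).and ((h0 ε hε).and (h1 ε hε)))
  obtain ⟨N, hN⟩ := hall (1 / 4) (by norm_num)
  -- Past `N`, all terms of the parity of a small term are small, the others are large.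
  have step : ∀ m ≥ N, t m ≤ 1 / 2 → ∀ n, t (m + 2 * n) ≤ 1 / 2 ∧ 1 / 2 < t (m + 2 * n + 1) := by
    intro m hm hs n
    induction n with
    | zero =>
      have := hN m hm
      exact ⟨hs, by rcases this.2.2 with h | h <;> norm_num at * <;> linarith⟩
    | succ n ih =>
      have A := hN (m + 2 * n + 1) (by lia)
      have B := hN (m + 2 * n + 2) (by lia)
      rw [show m + 2 * (n + 1) = m + 2 * n + 2 by ring]
      have a : t (m + 2 * n + 2) ≤ 1 / 2 := by
        rcases A.2.1 with h | h
        · linarith [ih.2]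
        · exact h.trans (by norm_num)
      refine ⟨a, ?_⟩
      rcases B.2.2 with h | h
      · linarith
      · linarith
  have conv : ∀ m ≥ N, t m ≤ 1 / 2 → Tendsto (fun n => t (m + 2 * n)) atTop (𝓝 0) ∧
      Tendsto (fun n => t (m + 2 * n + 1)) atTop (𝓝 1) := by
    intro m hm hs
    have S := step m hm hs
    constructor <;> rw [Metric.tendsto_atTop] <;> intro ε hε <;>
      obtain ⟨M, hM⟩ := hall (min (ε / 2) (1 / 4)) (by positivity) <;>
      refine ⟨M, fun n hn => ?_⟩ <;>
      have e1 := min_le_left (ε / 2) (1 / 4 : ℝ) <;>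
      have e2 := min_le_right (ε / 2) (1 / 4 : ℝ) <;>
      obtain ⟨A, B, C⟩ := hM (m + 2 * n) (by lia) <;>
      have A' := (hM (m + 2 * n + 1) (by lia)).1 <;>
      obtain ⟨s1, s2⟩ := S n <;>
      rw [Real.dist_eq, abs_lt]
    · rcases B with h | h <;> constructor <;> linarith
    · rcases C with h | h <;> constructor <;> linarith
  have hs : t (2 * N) ≤ 1 / 2 ∨ t (2 * N + 1) ≤ 1 / 2 := by
    rcases (hN (2 * N) (by lia)).2.1 with h | h
    · left; linarith
    · right; linarith
  rcases hs with h | h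
  · left
    obtain ⟨a, b⟩ := conv (2 * N) (by lia) h
    constructor
    · rw [← tendsto_add_atTop_iff_nat N]
      exact a.congr fun n => by congr 1; ring
    · rw [← tendsto_add_atTop_iff_nat N]
      exact b.congr fun n => by congr 1; ring
  · right
    obtain ⟨a, b⟩ := conv (2 * N + 1) (by lia) h
    constructor
    · rw [← tendsto_add_atTop_iff_nat (N + 1)]
      exact b.congr fun n => by congr 1; ring
    · rw [← tendsto_add_atTop_iff_nat N]
      exact a.congr fun n => by congr 1; ring

theorem eventually_neg_lt_along {α : ℕ → ℕ} {p q : ℝ × ℝ} (hpq : p ≠ q)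
    (hL : limitSet α = segment ℝ p q) {ε : ℝ} (hε : 0 < ε) :
    ∀ᶠ k in atTop, -ε < along p q (hatX α k) :=
  eventually_hatX_mem (U := {z | -ε < along p q z})
    (isOpen_lt continuous_const (continuous_along p q)) fun z hz => by
      have := (along_mem_Icc hpq (hL ▸ hz)).1
      show -ε < _
      linarith

/-- Of two consecutive points one comes close to the endpoint `p`: the mediant of the vectors of
index `k` and `k + 2` gives the larger weight to the one of index `k + 2`. -/
theorem eventually_along_le {α : ℕ → ℕ} {p q : ℝ × ℝ} (hpq : p ≠ q)
    (hL : limitSet α = segment ℝ p q) {ε : ℝ} (hε : 0 < ε) :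
    ∀ᶠ k in atTop, along p q (hatX α k) ≤ ε ∨ along p q (hatX α (k + 1)) ≤ ε := by
  have hp : p ∈ limitSet α := hL ▸ left_mem_segment ℝ p q
  obtain ⟨N, hN⟩ := eventually_atTop.1 (eventually_neg_lt_along hpq hL hε)
  refine eventually_atTop.2 ⟨N + 1, fun k hk => ?_⟩
  obtain ⟨m, rfl⟩ := Nat.exists_eq_add_of_le' (Nat.one_le_of_lt hk)
  obtain ⟨a, b, c, ha, hc, hcb, hs, hx⟩ := exists_comb_of_mem_limitSet hp m
  have e := along_comb p q (hatX α (m + 1)) (hatX α (m + 2)) (hatX α m) hs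
  rw [← hx, along_left] at e
  have h0 := hN m (by lia)
  by_contra! h
  obtain ⟨h1, h2⟩ := h
  rw [show m + 1 + 1 = m + 2 by rfl] at h2
  have hb : 0 ≤ b := hc.trans hcb
  have hab : 0 < a + b := by linarith
  have i0 : 0 ≤ c * (along p q (hatX α m) + ε) := mul_nonneg hc (by linarith)
  have i1 : 0 ≤ a * (along p q (hatX α (m + 1)) - ε) := mul_nonneg ha (by linarith)
  have i2 : 0 ≤ b * (along p q (hatX α (m + 2)) - ε) := mul_nonneg hb (by linarith)
  have i3 : 0 ≤ (b - c) * ε := mul_nonneg (by linarith) hε.le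
  -- By `e`, the sum of these four terms is `-a * ε`, so `a = 0`, and then `b` is positive.
  rcases ha.eq_or_lt with rfl | ha
  · have : 0 < b * (along p q (hatX α (m + 2)) - ε) := mul_pos (by linarith) (by linarith)
    linarith
  · have : 0 < a * ε := mul_pos ha hε
    linarith

theorem tendsto_across_hatX {α : ℕ → ℕ} {p q : ℝ × ℝ}
    (hL : limitSet α = segment ℝ p q) : Tendsto (fun k => across p q (hatX α k)) atTop (𝓝 0) := by
  rw [Metric.tendsto_nhds]
  intro ε hε
  refine eventually_hatX_mem (U := {z | dist (across p q z) 0 < ε})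
    (isOpen_lt ((continuous_across p q).dist continuous_const) continuous_const) fun z hz => ?_
  show dist (across p q z) 0 < ε
  rwa [across_eq_zero (hL ▸ hz), dist_self]

theorem exists_parity {α : ℕ → ℕ} {p q : ℝ × ℝ} (hpq : p ≠ q)
    (hL : limitSet α = segment ℝ p q) :
    (Tendsto (fun k => along p q (hatX α (2 * k))) atTop (𝓝 0) ∧
      Tendsto (fun k => along p q (hatX α (2 * k + 1))) atTop (𝓝 1)) ∨
    (Tendsto (fun k => along p q (hatX α (2 * k))) atTop (𝓝 1) ∧
      Tendsto (fun k => along p q (hatX α (2 * k + 1))) atTop (𝓝 0)) := by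
  have hL' : limitSet α = segment ℝ q p := by rw [hL, segment_symm]
  refine tendsto_even_odd_of_alternating (t := fun k => along p q (hatX α k)) (fun ε hε => ?_)
    (fun ε hε => eventually_along_le hpq hL hε) (fun ε hε => ?_)
  · filter_upwards [eventually_neg_lt_along hpq hL hε, eventually_neg_lt_along hpq.symm hL' hε]
      with k h1 h2
    rw [along_comm hpq] at h2
    exact ⟨h1, by linarith⟩
  · filter_upwards [eventually_along_le hpq.symm hL' hε] with k h
    rw [along_comm hpq, along_comm hpq] at h
    exact h.imp (fun h => by linarith) fun h => by linarith

theorem tendsto_of_along {p q : ℝ × ℝ} (hpq : p ≠ q) {f : ℕ → ℝ × ℝ} {c : ℝ}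
    (h1 : Tendsto (fun k => along p q (f k)) atTop (𝓝 c))
    (h2 : Tendsto (fun k => across p q (f k)) atTop (𝓝 0)) :
    Tendsto f atTop (𝓝 (p + c • (q - p))) := by
  have e : f = fun k => (p.1 + along p q (f k) * (q.1 - p.1) - across p q (f k) * (q.2 - p.2),
      p.2 + along p q (f k) * (q.2 - p.2) + across p q (f k) * (q.1 - p.1)) :=
    funext fun k => eq_along_across hpq (f k)
  have e' : p + c • (q - p) = (p.1 + c * (q.1 - p.1) - 0 * (q.2 - p.2),
      p.2 + c * (q.2 - p.2) + 0 * (q.1 - p.1)) := by ext <;> simp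
  rw [e, e']
  exact (((h1.mul_const _).const_add _).sub (h2.mul_const _)).prodMk_nhds
    (((h1.mul_const _).const_add _).add (h2.mul_const _))

theorem tendsto_of_even_odd {X : Type*} {l : Filter X} {f : ℕ → X}
    (h0 : Tendsto (fun k => f (2 * k)) atTop l) (h1 : Tendsto (fun k => f (2 * k + 1)) atTop l) :
    Tendsto f atTop l := by
  intro s hs
  obtain ⟨a, ha⟩ := eventually_atTop.1 (h0 hs)
  obtain ⟨b, hb⟩ := eventually_atTop.1 (h1 hs)
  refine eventually_atTop.2 ⟨2 * a + 2 * b, fun n hn => ?_⟩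
  obtain ⟨m, rfl | rfl⟩ := Nat.even_or_odd' n
  · exact ha m (by lia)
  · exact hb m (by lia)

theorem tendsto_hatX_sub {α : ℕ → ℕ} {p q : ℝ × ℝ}
    (h0 : Tendsto (fun k => hatX α (2 * k)) atTop (𝓝 p))
    (h1 : Tendsto (fun k => hatX α (2 * k + 1)) atTop (𝓝 q)) :
    Tendsto (fun k => hatX α (k + 2) - hatX α k) atTop (𝓝 0) := by
  refine tendsto_of_even_odd ?_ ?_
  · have := (h0.comp (tendsto_add_atTop_nat 1)).sub h0
    rwa [sub_self] at this
  · have := (h1.comp (tendsto_add_atTop_nat 1)).sub h1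
    rwa [sub_self] at this

/-- The denominators grow superexponentially: the point of index `k + 3` is a convex combination
of the three before it, where the two of index `k + 2` and `k` are far from it. -/
theorem tendsto_ratio {α : ℕ → ℕ} {p q : ℝ × ℝ} (hpq : p ≠ q)
    (h0 : Tendsto (fun k => hatX α (2 * k)) atTop (𝓝 p))
    (h1 : Tendsto (fun k => hatX α (2 * k + 1)) atTop (𝓝 q)) :
    Tendsto (fun k => rvec α (k + 5) 0 / rvec α (k + 6) 0) atTop (𝓝 0) := by
  choose a b c ha hb hc hs har hx using exists_comb_hatX α
  simp only [← har]
  set t : ℕ → ℝ := fun k => along p q (hatX α k) with ht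
  have hqq : along p q q = 1 := by have := along_comm hpq q; rw [along_left] at this; linarith
  have t0 : Tendsto (fun k => t (2 * k)) atTop (𝓝 0) :=
    along_left p q ▸ ((continuous_along p q).tendsto p).comp h0
  have t1 : Tendsto (fun k => t (2 * k + 1)) atTop (𝓝 1) :=
    hqq ▸ ((continuous_along p q).tendsto q).comp h1
  have hδ : Tendsto (fun k => (t (k + 1) - t k) ^ 2) atTop (𝓝 1) := by
    refine tendsto_of_even_odd ?_ ?_
    · simpa using (t1.sub t0).pow 2
    · have := ((t0.comp (tendsto_add_atTop_nat 1)).sub t1).pow 2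
      rwa [show ((0 : ℝ) - 1) ^ 2 = 1 by norm_num] at this
  have hη : Tendsto (fun k => t (k + 2) - t k) atTop (𝓝 0) := by
    refine tendsto_of_even_odd ?_ ?_
    · have := (t0.comp (tendsto_add_atTop_nat 1)).sub t0
      rwa [sub_self] at this
    · have := (t1.comp (tendsto_add_atTop_nat 1)).sub t1
      rwa [sub_self] at this
  have hη' := hη.abs
  have hη1 := (hη.comp (tendsto_add_atTop_nat 1)).abs
  simp only [abs_zero, Function.comp_def] at hη' hη1
  have hub : Tendsto (fun k => 4 * (|t (k + 1 + 2) - t (k + 1)| + |t (k + 2) - t k|)) atTop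
      (𝓝 0) := by simpa using (hη1.add hη').const_mul 4
  refine squeeze_zero' (Eventually.of_forall ha) ?_ hub
  have hδ' := (hδ.comp (tendsto_add_atTop_nat 1)).eventually_const_lt
    (show (1 / 4 : ℝ) < 1 by norm_num)
  filter_upwards [hδ'] with k hk
  have e : t (k + 3) = a k * t (k + 2) + b k * t (k + 1) + c k * t k := by
    simp only [ht]; rw [hx k, along_comb _ _ _ _ _ (hs k)]
  -- Replacing `t k` by `t (k + 2)` leaves a multiple of a difference that is close to `1` or `-1`.
  have e2 : (a k + c k) * (t (k + 2) - t (k + 1)) =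
      (t (k + 1 + 2) - t (k + 1)) + c k * (t (k + 2) - t k) := by
    rw [show k + 1 + 2 = k + 3 by rfl, e, show b k = 1 - a k - c k by linarith [hs k]]; ring
  have hd : 1 / 2 < |t (k + 2) - t (k + 1)| := by
    simp only [Function.comp] at hk
    rw [show (1 / 4 : ℝ) = (1 / 2) ^ 2 by norm_num, ← sq_abs (t _ - _)] at hk
    exact lt_of_pow_lt_pow_left₀ 2 (abs_nonneg _) hk
  have hc1 : c k ≤ 1 := by linarith [ha k, hb k, hs k]
  have e3 : (a k + c k) * |t (k + 2) - t (k + 1)| ≤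
      |t (k + 1 + 2) - t (k + 1)| + |t (k + 2) - t k| := by
    rw [← abs_of_nonneg (add_nonneg (ha k) (hc k)), ← abs_mul, e2]
    refine (abs_add_le _ _).trans (add_le_add le_rfl ?_)
    rw [abs_mul, abs_of_nonneg (hc k)]
    exact mul_le_of_le_one_left (abs_nonneg _) hc1
  have := ha k
  have := hc k
  have : a k * (1 / 2) ≤ (a k + c k) * |t (k + 2) - t (k + 1)| := by gcongr; linarith
  have := abs_nonneg (t (k + 1 + 2) - t (k + 1))
  have := abs_nonneg (t (k + 2) - t k)
  linarith

/-! ### Compositions of the inverse branches -/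

theorem phi1_iterate_phi0 {z : ℝ × ℝ} (h1 : 0 ≤ z.1) (h2 : 0 ≤ z.2) (a : ℕ) :
    phi1^[a] (phi0 z) = (1 / (1 + z.2 + a * z.1), z.1 / (1 + z.2 + a * z.1)) := by
  induction a with
  | zero => simp [phi0]
  | succ a ih =>
    rw [Function.iterate_succ_apply', ih, phi1]
    have : 0 < 1 + z.2 + a * z.1 := by positivity
    have : 0 < 1 + z.2 + (a + 1) * z.1 := by positivity
    have e : 1 + z.1 / (1 + z.2 + a * z.1) = (1 + z.2 + (a + 1) * z.1) / (1 + z.2 + a * z.1) := by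
      field_simp; ring
    push_cast
    ext <;> simp only [e] <;> field_simp

/-- The image, in homogeneous coordinates, of `z` under the projective map `phiComp α k`: it sends
the vertices `(0, 0)`, `(1, 0)`, `(1, 1)` to the vectors of index `k + 2`, `k + 3`, and the sum of
those of index `k + 1` and `k + 3`. -/
def imageVec (α : ℕ → ℕ) (k : ℕ) (z : ℝ × ℝ) (i : Fin 3) : ℝ :=
  (1 - z.1) * rvec α (k + 2) i + z.1 * rvec α (k + 3) i + z.2 * rvec α (k + 1) i

theorem phiComp_eq (α : ℕ → ℕ) (k : ℕ) {z : ℝ × ℝ} (h1 : z.1 ≤ 1) (h2 : z.2 ≤ z.1) (h3 : 0 ≤ z.2) :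
    phiComp α k z = (imageVec α k z 1 / imageVec α k z 0, imageVec α k z 2 / imageVec α k z 0) := by
  induction k generalizing z with
  | zero =>
    rw [phiComp, Function.comp_apply, phi1_iterate_phi0 (h3.trans h2) h3]
    have e0 : imageVec α 0 z 0 = 1 + z.2 + α 0 * z.1 := by simp [imageVec, rvec, vec]; ring
    have e1 : imageVec α 0 z 1 = 1 := by simp [imageVec, rvec, vec]
    have e2 : imageVec α 0 z 2 = z.1 := by simp [imageVec, rvec, vec]
    rw [e0, e1, e2]
  | succ k ih =>
    have hx := h3.trans h2
    have hS : 1 ≤ 1 + z.2 + α (k + 1) * z.1 := by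
      have : 0 ≤ z.2 + α (k + 1) * z.1 := by positivity
      linarith
    rw [phiComp, Function.comp_apply, Function.comp_apply, phi1_iterate_phi0 hx h3]
    set S := 1 + z.2 + α (k + 1) * z.1 with hSd
    have hS0 : 0 < S := by linarith
    have e : ∀ i, imageVec α (k + 1) z i = S * imageVec α k (1 / S, z.1 / S) i := by
      intro i
      simp only [imageVec, rvec_add_three α (k + 1),
        show k + 1 + 2 = k + 3 by rfl, show k + 1 + 1 = k + 2 by rfl]
      field_simp
      rw [hSd]
      ring
    rw [ih ((div_le_one hS0).2 hS) (by show z.1 / S ≤ 1 / S; gcongr)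
      (div_nonneg hx hS0.le), e, e, e, mul_div_mul_left _ _ hS0.ne', mul_div_mul_left _ _ hS0.ne']

theorem phiComp_zero (α : ℕ → ℕ) (k : ℕ) : phiComp α (k + 1) (0, 0) = hatX α k := by
  rw [phiComp_eq α _ (by simp) (by simp) (by simp)]
  simp [imageVec, hatX, pairOf, rvec, add_assoc]

/-- The weight `a` is at most a multiple of the ratio of consecutive denominators, which tends to
zero, whereas `b` is only bounded. -/
theorem exists_comb_phiComp (α : ℕ → ℕ) (k : ℕ) {z : ℝ × ℝ} (h1 : z.1 ≤ 1) (h2 : z.2 ≤ z.1)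
    (h3 : 0 ≤ z.2) (h : 0 < z.1) :
    ∃ a b : ℝ, 0 ≤ a ∧ a ≤ rvec α (k + 5) 0 / rvec α (k + 6) 0 / z.1 ∧ 0 ≤ b ∧ b ≤ 1 ∧
      phiComp α (k + 3) z - hatX α (k + 3) =
        a • (hatX α (k + 2) - hatX α (k + 3)) + b • (hatX α (k + 1) - hatX α (k + 3)) := by
  have q1 : 0 < rvec α (k + 4) 0 := rvec_zero_pos α (k + 3)
  have q2 : 0 < rvec α (k + 5) 0 := rvec_zero_pos α (k + 4)
  have q3 : 0 < rvec α (k + 6) 0 := rvec_zero_pos α (k + 5)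
  have q13 : rvec α (k + 4) 0 ≤ rvec α (k + 6) 0 :=
    (rvec_zero_le α (k + 1)).trans (rvec_zero_le α (k + 2))
  have hx : 0 ≤ 1 - z.1 := by linarith
  have e : ∀ i, imageVec α (k + 3) z i = (1 - z.1) * rvec α (k + 5) i + z.1 * rvec α (k + 6) i
    + z.2 * rvec α (k + 4) i := fun i => rfl
  have hS : z.1 * rvec α (k + 6) 0 ≤ imageVec α (k + 3) z 0 := by
    have : 0 ≤ (1 - z.1) * rvec α (k + 5) 0 := by positivity
    have : 0 ≤ z.2 * rvec α (k + 4) 0 := by positivity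
    linarith [e 0]
  have hxq : 0 < z.1 * rvec α (k + 6) 0 := by positivity
  have hS0 := hxq.trans_le hS
  refine ⟨(1 - z.1) * rvec α (k + 5) 0 / imageVec α (k + 3) z 0,
    z.2 * rvec α (k + 4) 0 / imageVec α (k + 3) z 0, by positivity, ?_, by positivity, ?_, ?_⟩
  · rw [div_div, mul_comm (rvec α (k + 6) 0)]
    exact div_le_div₀ q2.le (mul_le_of_le_one_left q2.le (by linarith)) hxq hS
  · rw [div_le_one hS0]
    exact (mul_le_mul h2 q13 q1.le h.le).trans hS
  · rw [phiComp_eq α _ h1 h2 h3]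
    have o1 : rvec α (k + 4) 1 = _ := rvec_one α (k + 1)
    have o2 : rvec α (k + 5) 1 = _ := rvec_one α (k + 2)
    have o3 : rvec α (k + 6) 1 = _ := rvec_one α (k + 3)
    have t1 : rvec α (k + 4) 2 = _ := rvec_two α (k + 1)
    have t2 : rvec α (k + 5) 2 = _ := rvec_two α (k + 2)
    have t3 : rvec α (k + 6) 2 = _ := rvec_two α (k + 3)
    simp only [add_assoc, Nat.reduceAdd] at o1 o2 o3 t1 t2 t3
    have e0 := e 0
    have e1 := e 1
    have e2 := e 2
    rw [o1, o2, o3] at e1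
    rw [t1, t2, t3] at e2
    ext
    · simp only [Prod.fst_add, Prod.fst_sub, Prod.smul_fst, smul_eq_mul]
      field_simp
      rw [e1, e0]
      ring
    · simp only [Prod.snd_add, Prod.snd_sub, Prod.smul_snd, smul_eq_mul]
      field_simp
      rw [e2, e0]
      ring

theorem tendsto_phiComp_sub {α : ℕ → ℕ} {p q z : ℝ × ℝ} (hpq : p ≠ q)
    (h0 : Tendsto (fun k => hatX α (2 * k)) atTop (𝓝 p))
    (h1 : Tendsto (fun k => hatX α (2 * k + 1)) atTop (𝓝 q))
    (hz1 : z.1 ≤ 1) (hz2 : z.2 ≤ z.1) (hz3 : 0 ≤ z.2) (hz : 0 < z.1) :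
    Tendsto (fun k => phiComp α k z - hatX α k) atTop (𝓝 0) := by
  rw [← tendsto_add_atTop_iff_nat 3]
  choose a b ha ha' hb hb' hx using
    fun k => exists_comb_phiComp α k hz1 hz2 hz3 hz
  have hd : Tendsto (fun k => ‖hatX α k - hatX α (k + 1)‖) atTop (𝓝 ‖p - q‖) := by
    refine tendsto_of_even_odd (h0.sub h1).norm ?_
    have := (h1.sub (h0.comp (tendsto_add_atTop_nat 1))).norm
    rwa [norm_sub_rev] at this
  have hd2 := (hd.comp (tendsto_add_atTop_nat 2))
  have hs := ((tendsto_hatX_sub h0 h1).comp (tendsto_add_atTop_nat 1)).norm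
  have hr := ((tendsto_ratio hpq h0 h1).div_const z.1).mul hd2
  have hlim := hr.add hs
  rw [zero_div, zero_mul, norm_zero, add_zero] at hlim
  refine squeeze_zero_norm (fun k => ?_) hlim
  rw [hx k]
  refine (norm_add_le _ _).trans (add_le_add ?_ ?_)
  · rw [norm_smul, Real.norm_of_nonneg (ha k)]
    exact mul_le_mul_of_nonneg_right (ha' k) (norm_nonneg _)
  · rw [norm_smul, Real.norm_of_nonneg (hb k), norm_sub_rev]
    exact mul_le_of_le_one_left (norm_nonneg _) (hb' k)

theorem closure_triangle_subset :
    closure triangle ⊆ {z : ℝ × ℝ | z.1 ≤ 1 ∧ z.2 ≤ z.1 ∧ 0 ≤ z.2} := by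
  refine closure_minimal (fun z hz => ⟨hz.1, hz.2.1, hz.2.2.le⟩) ?_
  exact (isClosed_le continuous_fst continuous_const).inter
    ((isClosed_le continuous_snd continuous_fst).inter
      (isClosed_le continuous_const continuous_snd))

/-- The conclusion once it is known at which endpoint the points of even index accumulate. -/
theorem limits_of_parity {α : ℕ → ℕ} {p q : ℝ × ℝ} (hpq : p ≠ q)
    (hL : limitSet α = segment ℝ p q)
    (h0 : Tendsto (fun k => along p q (hatX α (2 * k))) atTop (𝓝 0))
    (h1 : Tendsto (fun k => along p q (hatX α (2 * k + 1))) atTop (𝓝 1)) :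
    Tendsto (fun k : ℕ => hatX α (2 * k)) atTop (𝓝 p) ∧
      Tendsto (fun k : ℕ => hatX α (2 * k + 1)) atTop (𝓝 q) ∧
      (∀ z ∈ closure triangle \ {((0 : ℝ), (0 : ℝ))},
        Tendsto (fun k : ℕ => phiComp α (2 * k) z) atTop (𝓝 p) ∧
        Tendsto (fun k : ℕ => phiComp α (2 * k + 1) z) atTop (𝓝 q)) ∧
      Tendsto (fun k : ℕ => phiComp α (2 * k) (0, 0)) atTop (𝓝 q) ∧
      Tendsto (fun k : ℕ => phiComp α (2 * k + 1) (0, 0)) atTop (𝓝 p) := by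
  have c := tendsto_across_hatX hL
  have e : Tendsto (fun k : ℕ => 2 * k) atTop atTop :=
    tendsto_atTop_mono (fun k => (by lia : k ≤ 2 * k)) tendsto_id
  have o : Tendsto (fun k : ℕ => 2 * k + 1) atTop atTop :=
    tendsto_atTop_mono (fun k => (by lia : k ≤ 2 * k + 1)) tendsto_id
  have hp := tendsto_of_along hpq h0 (c.comp e)
  have hq := tendsto_of_along hpq h1 (c.comp o)
  rw [zero_smul, add_zero] at hp
  rw [one_smul, add_sub_cancel] at hq
  refine ⟨hp, hq, fun z hz => ?_, ?_, ?_⟩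
  · obtain ⟨h1, h2, h3⟩ := closure_triangle_subset hz.1
    have hz0 : 0 < z.1 := (h3.trans h2).lt_of_ne' fun h =>
      hz.2 (Prod.ext h (le_antisymm (h2.trans h.le) h3))
    have hs := tendsto_phiComp_sub hpq hp hq h1 h2 h3 hz0
    constructor
    · simpa using (hs.comp e).add hp
    · simpa using (hs.comp o).add hq
  · rw [← tendsto_add_atTop_iff_nat 1]
    exact hq.congr fun k => (phiComp_zero α (2 * k + 1)).symm
  · exact hp.congr fun k => (phiComp_zero α (2 * k)).symm

end TriangleSeq

theorem proposition4p4 (α : ℕ → ℕ) (hα : TriangleSeq.NonConvergent α) :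
    ∃ p q : ℝ × ℝ, p ≠ q ∧ TriangleSeq.limitSet α = segment ℝ p q ∧
      Tendsto (fun k : ℕ => TriangleSeq.hatX α (2 * k)) atTop (𝓝 p) ∧
      Tendsto (fun k : ℕ => TriangleSeq.hatX α (2 * k + 1)) atTop (𝓝 q) ∧
      (∀ z ∈ closure TriangleSeq.triangle \ {((0 : ℝ), (0 : ℝ))},
        Tendsto (fun k : ℕ => TriangleSeq.phiComp α (2 * k) z) atTop (𝓝 p) ∧
        Tendsto (fun k : ℕ => TriangleSeq.phiComp α (2 * k + 1) z) atTop (𝓝 q)) ∧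
      Tendsto (fun k : ℕ => TriangleSeq.phiComp α (2 * k) (0, 0)) atTop (𝓝 q) ∧
      Tendsto (fun k : ℕ => TriangleSeq.phiComp α (2 * k + 1) (0, 0)) atTop (𝓝 p) := by
  obtain ⟨p, q, hpq, hL⟩ := TriangleSeq.exists_limitSet_eq_segment hα
  rcases TriangleSeq.exists_parity hpq hL with ⟨h0, h1⟩ | ⟨h0, h1⟩
  · exact ⟨p, q, hpq, hL, TriangleSeq.limits_of_parity hpq hL h0 h1⟩
  · have hL' : TriangleSeq.limitSet α = segment ℝ q p := by rw [hL, segment_symm]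
    refine ⟨q, p, hpq.symm, hL', TriangleSeq.limits_of_parity hpq.symm hL' ?_ ?_⟩
    · simpa only [TriangleSeq.along_comm hpq, sub_self] using h0.const_sub 1
    · simpa only [TriangleSeq.along_comm hpq, sub_zero] using h1.const_sub 1
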